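/- Let $n\ge 1$. A real $n\times n$ matrix is a Z-matrix if its off-diagonal entries are all nonpositive, and it is irreducible if its directed graph (an edge from $i$ to $j$ whenever the $(i,j)$ entry is nonzero) is strongly connected. For $0\le s\le n$, $L_s$ is the set of all $n\times n$ matrices of the form $\tau I-M$ with $\tau\in\mathbb{R}$, $M$ an entrywise nonnegative matrix and $\rho_s(M)\le \tau<\rho_{s+1}(M)$, where $\rho_k(M)$ is the maximum of the spectral radii of the $k\times k$ principal submatrices of $M$ for $1\le k\le n$, $\rho_0(M)=-\infty$ and $\rho_{n+1}(M)=\infty$. A matrix $A$ is of weak type D with parameters $a_1,\dots,a_n$ if its $(i,j)$ entry is $a_{\min\{i,j\}}$; a matrix $B$ is of flipped weak type D with parameters $b_1,\dots,b_n$ if its $(i,j)$ entry is $b_{\max\{i,j\}}$ (equivalently, reversing the order of the indices turns it into a matrix of weak type D). The symbol $\circ$ denotes the entrywise product. **Theorem.** Let $C\in\mathbb{R}^{n\times n}$ be nonsingular and irreducible, and suppose that $C^{-1}$ is a tridiagonal Z-matrix. Let $D$ be a diagonal matrix with positive diagonal entries such that $DC=A\circ B$, where $A$ is of weak type D with parameters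 $a_i$, $B$ is of flipped weak type D with parameters $b_i$, and $a_ib_{i-1}-a_{i-1}b_i>0$ for $i=2,\dots,n$. Then: (i) if $\det C<0$, then $C^{-1}\in L_s$ with $s=\min\{t-2,\;n-r-2\}$; (ii) if $\det C>0$, then $C^{-1}\in L_s$ with $s=\min\{t-2,\;n-q-2\}$. Here the integers $t,r,q$ are defined as follows, where $i$ always satisfies $1\le i$ and $i+j\le n$: - $t=n+2$ if $a_{i+j}b_i-a_ib_{i+j}\ge 0$ for all $i$ and all $j\ge 1$; otherwise $t$ is the smallest $j\ge 1$ such that $a_{i+j}b_i-a_ib_{i+j}<0$ for some $i$; - $r=-1$ if $a_ib_{i+j}\le 0$ for all $i$ and all $j\ge 0$; otherwise $r$ is the largest $j\ge 0$ such that $a_ib_{i+j}>0$ for some $i$; - $q=-2$ if $a_ib_{i+j}>0$ for all $i$ and all $j\ge 0$; otherwise $q$ is the largest $j\ge 0$ such that $a_ib_{i+j}<0$ for some $i$ (in case (ii) such a $j$ then exists). In particular, the value of $s$ given in (i) and (ii) is an integer with $0\le s\le n$. -/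

import Mathlib

open scoped Matrix

noncomputable section

namespace ZClass

/-- A Z-matrix: all off-diagonal entries are nonpositive. -/
def IsZMatrix {n : ℕ} (A : Matrix (Fin n) (Fin n) ℝ) : Prop :=
  ∀ i j, i ≠ j → A i j ≤ 0

/-- A tridiagonal matrix: the entries with `|i - j| > 1` vanish. -/
def IsTridiagonal {n : ℕ} (A : Matrix (Fin n) (Fin n) ℝ) : Prop :=
  ∀ i j : Fin n, ((i : ℕ) + 1 < (j : ℕ) ∨ (j : ℕ) + 1 < (i : ℕ)) → A i j = 0

/-- An irreducible matrix: its directed graph, with an edge from `i` to `j` whenever the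
`(i, j)` entry is nonzero, is strongly connected. (Mathlib's `Matrix.IsIrreducible` is only about
entrywise nonnegative matrices.) -/
def IsIrreducible {n : ℕ} (A : Matrix (Fin n) (Fin n) ℝ) : Prop :=
  ∀ i j : Fin n, Relation.ReflTransGen (fun k l : Fin n => A k l ≠ 0) i j

/-- The spectral radius of a real square matrix, i.e. the largest modulus of its complex
eigenvalues. -/
def specRadius {ι : Type} [Fintype ι] [DecidableEq ι] (M : Matrix ι ι ℝ) : ENNReal :=
  spectralRadius ℂ (M.map (algebraMap ℝ ℂ))

/-- `rho B s` is the maximum of the spectral radii of the `s × s` principal submatrices of `B`,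
with the conventions that it is `-∞` for `s = 0` and `∞` for `s > n`. -/
def rho {n : ℕ} (B : Matrix (Fin n) (Fin n) ℝ) (s : ℕ) : EReal :=
  if s = 0 then ⊥
  else if n < s then ⊤
  else ⨆ S ∈ (Finset.univ : Finset (Fin n)).powersetCard s,
    ((specRadius (B.submatrix (fun i : S => (i : Fin n)) (fun i : S => (i : Fin n))) : ENNReal) :
      EReal)

/-- The class `L_s`, `0 ≤ s ≤ n`, of real `n × n` matrices `A = t I - B` with `B` entrywise
nonnegative and `ρ_s(B) ≤ t < ρ_{s+1}(B)`. -/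
def classL (n s : ℕ) : Set (Matrix (Fin n) (Fin n) ℝ) :=
  {A | s ≤ n ∧ ∃ (t : ℝ) (B : Matrix (Fin n) (Fin n) ℝ),
    (∀ i j, 0 ≤ B i j) ∧ A = t • (1 : Matrix (Fin n) (Fin n) ℝ) - B ∧
      rho B s ≤ (t : EReal) ∧ (t : EReal) < rho B (s + 1)}

/-- `A` is of weak type D with parameters `a`. -/
def IsWeakTypeD {n : ℕ} (A : Matrix (Fin n) (Fin n) ℝ) (a : Fin n → ℝ) : Prop :=
  ∀ i j : Fin n, A i j = if i ≤ j then a i else a j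

/-- `B` is of flipped weak type D with parameters `b`: reversing the order of the indices gives a
matrix of weak type D. The parameters are numbered so that `b i` is the `i`-th diagonal entry
of `B`. -/
def IsFlippedWeakTypeD {n : ℕ} (B : Matrix (Fin n) (Fin n) ℝ) (b : Fin n → ℝ) : Prop :=
  IsWeakTypeD (B.submatrix Fin.rev Fin.rev) (fun i => b i.rev)

open scoped Classical in
/-- The index `t`: it is `n + 2` if `a_{i+j} b_i - a_i b_{i+j} ≥ 0` for all `i` and all `j ≥ 1`
with `i + j` in range, and otherwise the least `j ≥ 1` for which some
`a_{i+j} b_i - a_i b_{i+j}` is negative. -/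
def tIndex {n : ℕ} (a b : Fin n → ℝ) : ℤ :=
  if ∀ i k : Fin n, i < k → 0 ≤ a k * b i - a i * b k then (n : ℤ) + 2
  else ((sInf {j : ℕ | 1 ≤ j ∧ ∃ i k : Fin n, (k : ℕ) = (i : ℕ) + j ∧
    a k * b i - a i * b k < 0} : ℕ) : ℤ)

open scoped Classical in
/-- The index `r`: it is `-1` if `a_i b_{i+j} ≤ 0` for all `i` and all `j ≥ 0` with `i + j` in
range, and otherwise the largest `j ≥ 0` for which some `a_i b_{i+j}` is positive. -/
def rIndex {n : ℕ} (a b : Fin n → ℝ) : ℤ :=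
  if ∀ i k : Fin n, i ≤ k → a i * b k ≤ 0 then -1
  else ((sSup {j : ℕ | ∃ i k : Fin n, (k : ℕ) = (i : ℕ) + j ∧ 0 < a i * b k} : ℕ) : ℤ)

open scoped Classical in
/-- The index `q`: it is `-2` if `a_i b_{i+j} > 0` for all `i` and all `j ≥ 0` with `i + j` in
range, and otherwise the largest `j ≥ 0` for which some `a_i b_{i+j}` is negative. -/
def qIndex {n : ℕ} (a b : Fin n → ℝ) : ℤ :=
  if ∀ i k : Fin n, i ≤ k → 0 < a i * b k then -2
  else ((sSup {j : ℕ | ∃ i k : Fin n, (k : ℕ) = (i : ℕ) + j ∧ a i * b k < 0} : ℕ) : ℤ)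

end ZClass

end

/-!
Indices run over `1, …, n` here. Write `Z = C⁻¹`. With `G = DC` the Green's matrix
`a (min i j) * b (max i j)`, the matrix `Z` is symmetric with respect to the weight `d`, and the
sequences `a i / d i` and `b i / d i`, extended by suitable values at the added indices `0` and
`n + 1`, span the solutions of the three-term recurrence of `Z` (`isSolutionPair_inv`). Let `[i, k]`
be the `bracket` of these two.
The brackets `[i, i + 1]` are positive, and for fixed `p` the sequence `[p, ·]` is the solution that
vanishes at `p`.

If `[p, m] < 0`, then on the indices strictly between `p` and `m` the vector `[p, ·]` is mapped by
the principal submatrix of `Z` to a negative multiple of the last unit vector. For the least gap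
`m - p` its entries are nonnegative, so the quadratic form of that submatrix, which is symmetric up
to the weight, is not positive semidefinite, and `M = τ - Z` has an eigenvalue above `τ` there
(`lt_rho`). Conversely, if all brackets up to gap `s + 1` are nonnegative, then these vectors, on the
runs of consecutive indices of a set `S` of size `s`, give a positive vector that the principal
submatrix of `Z` on `S` maps to a nonnegative one, so its counterpart in `M` has spectral radius at
most `τ` (`rho_le`). Hence `Z` belongs to `L_s` where `s + 2` is the least gap of a negative bracket,
and to `L_n` if there is none (`mem_classL`).

Brackets between indices in `1, …, n` give `t`. Up to positive factors the others are
`[0, k] = a_k a_1`, `[i, n + 1] = b_n b_i` and `[0, n + 1] = a_1 b_n`; the last has the sign of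
`det C` (`exists_pos_mul_det`), and the least gap of a negative one is `n - r` or `n - q`
(`exists_mem_classL`).
-/

open scoped Matrix

noncomputable section

namespace ZClass

/-! ### Bounds for the spectral radius -/

/-- The easy half of the Collatz–Wielandt principle. -/
theorem specRadius_le_of_mulVec_le {ι : Type} [Fintype ι] [DecidableEq ι]
    {M : Matrix ι ι ℝ} (hM : ∀ i j, 0 ≤ M i j) {τ : ℝ} (x : ι → ℝ) (hx : ∀ i, 0 < x i)
    (hMx : ∀ i, (M *ᵥ x) i ≤ τ * x i) : specRadius M ≤ ENNReal.ofReal τ := by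
  refine iSup₂_le fun k hk => ?_
  rw [← Matrix.spectrum_toLin', ← Module.End.hasEigenvalue_iff_mem_spectrum] at hk
  obtain ⟨v, hv⟩ := hk.exists_hasEigenvector
  have hv1 := hv.apply_eq_smul
  have hv0 := hv.2
  rw [Matrix.toLin'_apply] at hv1
  have hne : Nonempty ι := by
    by_contra h
    rw [not_nonempty_iff] at h
    exact hv0 (Subsingleton.elim _ _)
  -- The eigenvector is compared with `x` at an index where `‖v i‖ / x i` is largest.
  obtain ⟨i, -, hi⟩ := Finset.exists_max_image Finset.univ (fun i => ‖v i‖ / x i)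
    Finset.univ_nonempty
  have hle : ∀ j, ‖v j‖ ≤ ‖v i‖ / x i * x j := fun j =>
    (div_le_iff₀ (hx j)).1 (hi j (Finset.mem_univ j))
  have hvi : 0 < ‖v i‖ := by
    by_contra h
    have h0 : ‖v i‖ = 0 := le_antisymm (not_lt.1 h) (norm_nonneg _)
    refine hv0 (funext fun j => norm_le_zero_iff.1 ?_)
    simpa [h0] using hle j
  have key : ‖k‖ * ‖v i‖ ≤ τ * ‖v i‖ := by
    calc ‖k‖ * ‖v i‖ = ‖∑ j, (M i j : ℂ) * v j‖ := by
          rw [← norm_mul, ← smul_eq_mul, ← Pi.smul_apply, ← hv1]; rfl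
      _ ≤ ∑ j, M i j * ‖v j‖ := by
          refine (norm_sum_le _ _).trans (le_of_eq (Finset.sum_congr rfl fun j _ => ?_))
          rw [norm_mul, Complex.norm_real, Real.norm_of_nonneg (hM i j)]
      _ ≤ ∑ j, M i j * (‖v i‖ / x i * x j) :=
          Finset.sum_le_sum fun j _ => mul_le_mul_of_nonneg_left (hle j) (hM i j)
      _ = ‖v i‖ / x i * (M *ᵥ x) i := by
          rw [Matrix.mulVec, dotProduct, Finset.mul_sum]
          exact Finset.sum_congr rfl fun j _ => by ring
      _ ≤ ‖v i‖ / x i * (τ * x i) :=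
          mul_le_mul_of_nonneg_left (hMx i) (div_nonneg hvi.le (hx i).le)
      _ = τ * ‖v i‖ := by field_simp [(hx i).ne']
  have hk : ‖k‖ ≤ τ := le_of_mul_le_mul_right key hvi
  rw [← enorm_eq_nnnorm, ← ofReal_norm]
  exact ENNReal.ofReal_le_ofReal hk

theorem ofReal_le_specRadius_of_mulVec_eq {ι : Type} [Fintype ι] [DecidableEq ι]
    {M : Matrix ι ι ℝ} {c : ℝ} {v : ι → ℝ} (hv : v ≠ 0) (hMv : M *ᵥ v = c • v) :
    ENNReal.ofReal c ≤ specRadius M := by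
  have h1 : c ∈ spectrum ℝ M := by
    rw [← Matrix.spectrum_toLin', ← Module.End.hasEigenvalue_iff_mem_spectrum]
    refine Module.End.hasEigenvalue_of_hasEigenvector
      (Module.End.hasEigenvector_iff.2 ⟨Module.End.mem_eigenspace_iff.2 ?_, hv⟩)
    rw [Matrix.toLin'_apply, hMv]
  have h2 : (algebraMap ℝ ℂ c) ∈ spectrum ℂ (M.map (algebraMap ℝ ℂ)) := by
    rw [Matrix.mem_spectrum_iff_isRoot_charpoly] at h1 ⊢
    rw [Matrix.charpoly_map]
    exact h1.map
  refine le_trans ?_ (le_iSup₂ (f := fun k (_ : k ∈ spectrum ℂ (M.map (algebraMap ℝ ℂ))) =>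
    (‖k‖₊ : ENNReal)) _ h2)
  rw [← enorm_eq_nnnorm, ← ofReal_norm]
  refine ENNReal.ofReal_le_ofReal ?_
  rw [norm_algebraMap', Real.norm_eq_abs]
  exact le_abs_self c

/-- If `τ - M` is symmetric with respect to the weight `d`, then a vector `y` outside its kernel on
which its quadratic form is nonpositive shows that the form is not positive semidefinite, so that
`M` has an eigenvalue larger than `τ`. -/
theorem ofReal_lt_specRadius_of_quadratic_nonpos {ι : Type} [Fintype ι] [DecidableEq ι]
    {M W : Matrix ι ι ℝ} {τ : ℝ} (hτ : 0 ≤ τ) (hW : W = τ • (1 : Matrix ι ι ℝ) - M)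
    (d : ι → ℝ) (hd : ∀ i, 0 < d i) (hsymm : ∀ i j, d i * W i j = d j * W j i)
    (y : ι → ℝ) (hy : W *ᵥ y ≠ 0) (hq : ∑ i, d i * y i * (W *ᵥ y) i ≤ 0) :
    ENNReal.ofReal τ < specRadius M := by
  have hs : ∀ i, 0 < √(d i) := fun i => Real.sqrt_pos.2 (hd i)
  have hss : ∀ i, √(d i) * √(d i) = d i := fun i => Real.mul_self_sqrt (hd i).le
  let H : Matrix ι ι ℝ := Matrix.of fun i j => √(d i) * W i j / √(d j)
  have hHv : ∀ v : ι → ℝ, ∀ i, (H *ᵥ v) i = √(d i) * (W *ᵥ fun j => v j / √(d j)) i := by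
    intro v i
    simp only [H, Matrix.mulVec, dotProduct, Matrix.of_apply, Finset.mul_sum]
    exact Finset.sum_congr rfl fun j _ => by ring
  have hH : H.IsHermitian := by
    refine Matrix.IsHermitian.ext fun i j => ?_
    simp only [H, Matrix.of_apply, star_trivial]
    rw [div_eq_div_iff (hs i).ne' (hs j).ne']
    linear_combination W j i * hss j - W i j * hss i - hsymm i j
  have hHw : ∀ i, (H *ᵥ fun j => √(d j) * y j) i = √(d i) * (W *ᵥ y) i := by
    intro i
    rw [hHv]
    congr 2
    ext j
    field_simp [(hs j).ne']
  have hnot : ¬ H.PosSemidef := by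
    intro hP
    have h0 : star (fun j => √(d j) * y j) ⬝ᵥ H *ᵥ (fun j => √(d j) * y j) = 0 := by
      refine le_antisymm ?_ (hP.dotProduct_mulVec_nonneg _)
      refine le_trans (le_of_eq ?_) hq
      rw [dotProduct]
      refine Finset.sum_congr rfl fun i _ => ?_
      rw [hHw, Pi.star_apply, star_trivial]
      calc √(d i) * y i * (√(d i) * (W *ᵥ y) i) = √(d i) * √(d i) * y i * (W *ᵥ y) i := by ring
        _ = _ := by rw [hss]
    rw [hP.dotProduct_mulVec_zero_iff] at h0
    refine hy (funext fun i => ?_)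
    have h1 := congrFun h0 i
    rw [hHw] at h1
    exact (mul_eq_zero.1 h1).resolve_left (hs i).ne'
  rw [hH.posSemidef_iff_eigenvalues_nonneg, Pi.le_def] at hnot
  push Not at hnot
  obtain ⟨k, hk⟩ := hnot
  set μ := hH.eigenvalues k with hμ
  have hk' : μ < 0 := hk
  set w : ι → ℝ := (hH.eigenvectorBasis k).ofLp with hw
  have hHk : H *ᵥ w = μ • w := hH.mulVec_eigenvectorBasis k
  have hw0 : w ≠ 0 := by
    intro h
    have := hH.eigenvectorBasis.orthonormal.ne_zero k
    exact this (by ext i; exact congrFun h i)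
  have hWv : ∀ i, (W *ᵥ fun j => w j / √(d j)) i = μ * (w i / √(d i)) := by
    intro i
    have h1 := congrFun hHk i
    rw [hHv, Pi.smul_apply, smul_eq_mul] at h1
    rw [← mul_div_assoc, eq_div_iff (hs i).ne', mul_comm, h1]
  have hMW : M = τ • (1 : Matrix ι ι ℝ) - W := by rw [hW]; abel
  refine lt_of_lt_of_le ?_ (ofReal_le_specRadius_of_mulVec_eq (c := τ - μ)
    (v := fun j => w j / √(d j)) ?_ ?_)
  · rw [ENNReal.ofReal_lt_ofReal_iff (by linarith)]
    linarith
  · intro h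
    refine hw0 (funext fun i => ?_)
    exact (div_eq_zero_iff.1 (congrFun h i)).resolve_right (hs i).ne'
  · ext i
    rw [hMW, Matrix.sub_mulVec, Matrix.smul_mulVec, Matrix.one_mulVec, Pi.sub_apply, hWv]
    simp only [Pi.smul_apply, smul_eq_mul]
    ring

/-! ### The determinant of a Green's matrix -/

/-- The bracket `f k * g i - f i * g k`, a discrete Wronskian of `f` and `g`. -/
def bracket (f g : ℕ → ℝ) (i k : ℕ) : ℝ := f k * g i - f i * g k

/-- The Green's matrix `f (min i j) * g (max i j)` with the factor `f 0` taken out of its first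
row. -/
def reducedGreen (m : ℕ) (f g : ℕ → ℝ) : Matrix (Fin (m + 1)) (Fin (m + 1)) ℝ :=
  Matrix.of fun i j => if (i : ℕ) = 0 then g j else f (min (i : ℕ) j) * g (max (i : ℕ) j)

/-- Subtracting `f 1` times the first row from the second leaves a single nonzero entry in the
second row; expanding along it gives a recursion. -/
theorem det_reducedGreen_succ (m : ℕ) (f g : ℕ → ℝ) :
    (reducedGreen (m + 1) f g).det =
      bracket f g 0 1 * (reducedGreen m (fun i => f (i + 1)) (fun i => g (i + 1))).det := by
  have h01 : (1 : Fin (m + 2)) ≠ 0 := by simp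
  rw [← Matrix.det_updateRow_add_smul_self (reducedGreen (m + 1) f g) h01 (-f 1),
    Matrix.det_succ_row _ 1, Finset.sum_eq_single 0]
  · have hsub : ((reducedGreen (m + 1) f g).updateRow 1
        (reducedGreen (m + 1) f g 1 + -f 1 • reducedGreen (m + 1) f g 0)).submatrix
        (Fin.succAbove 1) (Fin.succAbove 0) =
        reducedGreen m (fun i => f (i + 1)) (fun i => g (i + 1)) := by
      ext i j
      rw [Matrix.submatrix_apply, Matrix.updateRow_ne (Fin.succAbove_ne 1 i),
        Fin.succAbove_zero]
      refine Fin.cases ?_ (fun i => ?_) i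
      · have : (Fin.succAbove (1 : Fin (m + 2)) 0) = 0 := by
          rw [Fin.succAbove_ne_zero_zero h01]
        simp [this, reducedGreen]
      · have : (Fin.succAbove (1 : Fin (m + 2)) i.succ) = i.succ.succ := by
          rw [← Fin.succ_zero_eq_one, Fin.succ_succAbove_succ, Fin.succAbove_zero]
        simp [this, reducedGreen]
    rw [hsub]
    generalize (reducedGreen m (fun i => f (i + 1)) (fun i => g (i + 1))).det = D
    simp [reducedGreen, bracket]
    exact Or.inl (by ring)
  · intro j _ hj
    have hj' : 1 ≤ (j : ℕ) := Nat.one_le_iff_ne_zero.2 (fun h => hj (Fin.ext h))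
    simp [reducedGreen, hj']
  · simp

theorem det_reducedGreen (m : ℕ) (f g : ℕ → ℝ) :
    (reducedGreen m f g).det = g m * ∏ i ∈ Finset.range m, bracket f g i (i + 1) := by
  induction m generalizing f g with
  | zero => simp [reducedGreen]
  | succ m ih =>
    rw [det_reducedGreen_succ, ih, Finset.prod_range_succ']
    simp only [bracket]
    ring

theorem det_green (m : ℕ) (f g : ℕ → ℝ) :
    (Matrix.of fun i j : Fin (m + 1) => f (min (i : ℕ) j) * g (max (i : ℕ) j)).det =
      f 0 * g m * ∏ i ∈ Finset.range m, bracket f g i (i + 1) := by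
  have h : (Matrix.of fun i j : Fin (m + 1) => f (min (i : ℕ) j) * g (max (i : ℕ) j)) =
      (reducedGreen m f g).updateRow 0 (f 0 • reducedGreen m f g 0) := by
    ext i j
    by_cases hi : i = 0
    · subst hi
      simp [reducedGreen]
    · rw [Matrix.updateRow_ne hi]
      simp [reducedGreen, hi]
  rw [h, Matrix.det_updateRow_smul, Matrix.updateRow_eq_self, det_reducedGreen]
  ring

/-! ### Solutions of the three-term recurrence of a tridiagonal Z-matrix -/

/-- `Z` is a tridiagonal Z-matrix, symmetric with respect to the positive weight `d`, and `f`, `g`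
are two solutions of its three-term recurrence on `0, …, n + 1` with positive consecutive brackets.
The row `i : Fin n` of `Z` belongs to the index `i + 1`, and the first and last rows are extended by
the negative coefficients `l` and `u` at the added indices `0` and `n + 1`. -/
structure IsSolutionPair {n : ℕ} (Z : Matrix (Fin n) (Fin n) ℝ) (d : Fin n → ℝ) (l u : ℝ)
    (f g : ℕ → ℝ) : Prop where
  isZMatrix : IsZMatrix Z
  isTridiagonal : IsTridiagonal Z
  weight_pos : ∀ i, 0 < d i
  symm : ∀ i j, d i * Z i j = d j * Z j i
  l_neg : l < 0
  u_neg : u < 0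
  eq_left : ∀ i : Fin n, ∑ j, Z i j * f (j + 1) + (if (i : ℕ) = 0 then l * f 0 else 0) +
    (if (i : ℕ) + 1 = n then u * f (n + 1) else 0) = 0
  eq_right : ∀ i : Fin n, ∑ j, Z i j * g (j + 1) + (if (i : ℕ) = 0 then l * g 0 else 0) +
    (if (i : ℕ) + 1 = n then u * g (n + 1) else 0) = 0
  bracket_pos : ∀ i ≤ n, 0 < bracket f g i (i + 1)

theorem bracket_self (f g : ℕ → ℝ) (i : ℕ) : bracket f g i i = 0 := by
  simp [bracket]

theorem bracket_swap (f g : ℕ → ℝ) (i k : ℕ) : bracket f g k i = -bracket f g i k := by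
  simp [bracket]

/-- If the brackets `bracket f g p ·` are nonnegative up to `m`, those before `m` are positive: by
the Plücker relation a zero forces a sign change at the next index. -/
theorem bracket_pos_of_nonneg {f g : ℕ → ℝ} {p m : ℕ}
    (hpos : ∀ i < m, 0 < bracket f g i (i + 1))
    (hnn : ∀ i, p < i → i ≤ m → 0 ≤ bracket f g p i) (i : ℕ) (hpi : p < i) (him : i < m) :
    0 < bracket f g p i := by
  induction i, hpi using Nat.le_induction with
  | base => exact hpos p (by omega)
  | succ i hi ih =>
    have h1 := ih (by omega)
    refine lt_of_le_of_ne (hnn _ (by omega) him.le) fun h0 => ?_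
    have h2 := hnn (i + 2) (by omega) (by omega)
    have h3 := hpos i (by omega)
    have h4 := hpos (i + 1) (by omega)
    have plucker : bracket f g p i * bracket f g (i + 1) (i + 2) -
        bracket f g p (i + 1) * bracket f g i (i + 2) +
        bracket f g p (i + 2) * bracket f g i (i + 1) = 0 := by
      simp only [bracket]
      ring
    rw [← h0] at plucker
    nlinarith [mul_pos h1 h4, mul_nonneg h2 h3.le]

namespace IsSolutionPair

variable {n : ℕ} {Z : Matrix (Fin n) (Fin n) ℝ} {d : Fin n → ℝ} {l u : ℝ} {f g : ℕ → ℝ}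

theorem eq_bracket (h : IsSolutionPair Z d l u f g) (p : ℕ) (i : Fin n) :
    ∑ j, Z i j * bracket f g p (j + 1) + (if (i : ℕ) = 0 then l * bracket f g p 0 else 0) +
      (if (i : ℕ) + 1 = n then u * bracket f g p (n + 1) else 0) = 0 := by
  have h1 := h.eq_left i
  have h2 := h.eq_right i
  have h3 : ∑ j, Z i j * bracket f g p (j + 1) =
      g p * ∑ j, Z i j * f (j + 1) - f p * ∑ j, Z i j * g (j + 1) := by
    rw [Finset.mul_sum, Finset.mul_sum, ← Finset.sum_sub_distrib]
    refine Finset.sum_congr rfl fun j _ => ?_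
    simp only [bracket]
    ring
  rw [h3]
  simp only [bracket]
  split_ifs at h1 h2 ⊢ <;> linear_combination g p * h1 - f p * h2

/-- A row of a principal submatrix, applied to a vector that agrees with `bracket f g p ·` where the
row does not vanish, only sees what the recurrence loses outside the index set. -/
theorem sum_eq_neg (h : IsSolutionPair Z d l u f g) (p : ℕ) (i : Fin n) (S : Finset (Fin n))
    (x : Fin n → ℝ) (hx : ∀ j ∈ S, Z i j * x j = Z i j * bracket f g p (j + 1)) :
    ∑ j ∈ S, Z i j * x j = -(∑ j ∈ Sᶜ, Z i j * bracket f g p (j + 1) +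
      (if (i : ℕ) = 0 then l * bracket f g p 0 else 0) +
      (if (i : ℕ) + 1 = n then u * bracket f g p (n + 1) else 0)) := by
  have h1 := h.eq_bracket p i
  rw [← Finset.sum_add_sum_compl S] at h1
  rw [Finset.sum_congr rfl hx]
  linarith

theorem eq_or_of_ne_zero (h : IsSolutionPair Z d l u f g) {i j : Fin n} (hij : Z i j ≠ 0) :
    (j : ℕ) = i ∨ (j : ℕ) + 1 = i ∨ (i : ℕ) + 1 = j := by
  by_contra hc
  push Not at hc
  exact hij (h.isTridiagonal i j (by omega))

/-- The superdiagonal entries do not vanish: in the recurrence for the solution that is zero at the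
row's own index, a vanishing superdiagonal entry makes the subdiagonal one vanish, and by symmetry
the superdiagonal entry of the previous row. -/
theorem superdiagonal_neg (h : IsSolutionPair Z d l u f g) (i j : Fin n)
    (hij : (j : ℕ) = i + 1) : Z i j < 0 := by
  obtain ⟨i, hi⟩ := i
  induction i generalizing j with
  | zero =>
    refine lt_of_le_of_ne (h.isZMatrix _ _ fun he => by rw [← he] at hij; simp at hij) fun h0 => ?_
    have h1 := h.eq_bracket 1 ⟨0, hi⟩
    have hj := j.2
    simp only at hij
    rw [Finset.sum_eq_zero, if_pos rfl, if_neg (by simp only; omega)] at h1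
    · have h2 := h.bracket_pos 0 (by omega)
      rw [bracket_swap] at h1
      nlinarith [h.l_neg]
    · intro k _
      by_cases hk : Z ⟨0, hi⟩ k = 0
      · rw [hk, zero_mul]
      · rcases h.eq_or_of_ne_zero hk with hk' | hk' | hk'
        · simp only at hk'
          rw [hk', bracket_self, mul_zero]
        · simp at hk'
        · exact absurd (by rw [show k = j from Fin.ext (by simp only at hk'; omega), h0]) hk
  | succ i ih =>
    refine lt_of_le_of_ne (h.isZMatrix _ _ fun he => by rw [← he] at hij; simp at hij) fun h0 => ?_
    have hi' : i < n := by omega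
    have hj := j.2
    have h1 := h.eq_bracket (i + 2) ⟨i + 1, hi⟩
    simp only at hij
    rw [Finset.sum_eq_single ⟨i, hi'⟩, if_neg (by simp), if_neg (by simp only; omega)] at h1
    · have h2 := h.bracket_pos (i + 1) (by omega)
      have h3 := ih ⟨i + 1, hi⟩ hi' rfl
      have h4 := h.symm ⟨i, hi'⟩ ⟨i + 1, hi⟩
      have h5 : Z ⟨i + 1, hi⟩ ⟨i, hi'⟩ = 0 := by
        simp only [bracket_swap f g (i + 1) (i + 2)] at h1
        have h6 := h2.ne'
        simpa [h6] using h1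
      rw [h5, mul_zero] at h4
      exact (mul_neg_of_pos_of_neg (h.weight_pos _) h3).ne h4
    · intro k _ hki
      by_cases hk : Z ⟨i + 1, hi⟩ k = 0
      · rw [hk, zero_mul]
      · rcases h.eq_or_of_ne_zero hk with hk' | hk' | hk'
        · simp only at hk'
          rw [hk', bracket_self, mul_zero]
        · exact absurd (Fin.ext (by simp only at hk' ⊢; omega)) hki
        · exact absurd (by rw [show k = j from Fin.ext (by simp only at hk'; omega), h0]) hk
    · simp

/-! ### The two inequalities that define the class of a matrix -/

/-- If brackets of gap at most `s + 1` are nonnegative, then `ρ_s(M) ≤ τ`: on each run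
`p + 1, …, m - 1` of consecutive indices of `S` the vector `bracket f g p ·` is positive, and the
principal submatrix of `Z = τ - M` on `S` maps it to a nonnegative vector. -/
theorem rho_le (h : IsSolutionPair Z d l u f g) {M : Matrix (Fin n) (Fin n) ℝ} {τ : ℝ}
    (hτ : 0 ≤ τ) (hM : ∀ i j, 0 ≤ M i j) (hZM : Z = τ • (1 : Matrix (Fin n) (Fin n) ℝ) - M)
    {s : ℕ} (hs : s ≤ n)
    (hnn : ∀ i k, i < k → k ≤ n + 1 → k ≤ i + s + 1 → 0 ≤ bracket f g i k) :
    rho M s ≤ (τ : EReal) := by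
  classical
  rw [rho]
  split_ifs with hs0 hns
  · exact bot_le
  · omega
  refine iSup₂_le fun S hS => ?_
  have hcard : S.card = s := (Finset.mem_powersetCard.1 hS).2
  rw [← max_eq_left hτ, ← EReal.coe_ennreal_ofReal, EReal.coe_ennreal_le_coe_ennreal_iff]
  -- `start k` is the largest index `≤ k` that does not belong to a member of `S`; it exists since
  -- the index `0` belongs to no row.
  let start : ℕ → ℕ := Nat.findGreatest fun k => ∀ j ∈ S, (j : ℕ) + 1 ≠ k
  have hstart_le : ∀ j ∈ S, start (j + 1) ≤ j := by
    intro j hj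
    have : start (j + 1) = start j := Nat.findGreatest_of_not fun hP => hP j hj rfl
    rw [this]
    exact Nat.findGreatest_le _
  have hrun : ∀ i k, start i < k → k ≤ i → ∃ j ∈ S, (j : ℕ) + 1 = k := by
    intro i k h1 h2
    have := Nat.findGreatest_is_greatest (P := fun k => ∀ j ∈ S, (j : ℕ) + 1 ≠ k) h1 h2
    push Not at this
    exact this
  have hlen : ∀ i, i ≤ start i + s := by
    intro i
    have hsub : Finset.Ioc (start i) i ⊆ S.image fun j : Fin n => (j : ℕ) + 1 := by
      intro k hk
      obtain ⟨h1, h2⟩ := Finset.mem_Ioc.1 hk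
      exact Finset.mem_image.2 (hrun i k h1 h2)
    have h1 := (Finset.card_le_card hsub).trans Finset.card_image_le
    rw [Nat.card_Ioc, hcard] at h1
    omega
  let x : Fin n → ℝ := fun j => bracket f g (start (j + 1)) (j + 1)
  have hxpos : ∀ j ∈ S, 0 < x j := by
    intro j hj
    have h1 := hstart_le j hj
    have h2 := hlen (j + 1)
    have h3 := j.2
    exact bracket_pos_of_nonneg (m := j + 2) (fun i hi => h.bracket_pos i (by omega))
      (fun i h4 h5 => hnn _ _ h4 (by omega) (by omega)) _ (by omega) (by omega)
  have hZx : ∀ i ∈ S, 0 ≤ ∑ j ∈ S, Z i j * x j := by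
    intro i hi
    have hi1 := hstart_le i hi
    have hi2 := hlen (i + 1)
    rw [h.sum_eq_neg (start (i + 1)) i S x, neg_nonneg]
    · refine add_nonpos (add_nonpos (Finset.sum_nonpos fun j hj => ?_) ?_) ?_
      · rw [Finset.mem_compl] at hj
        by_cases hij : Z i j = 0
        · rw [hij, zero_mul]
        rcases h.eq_or_of_ne_zero hij with hk | hk | hk
        · exact absurd (by rw [Fin.ext hk]; exact hi) hj
        · have : start (i + 1) = j + 1 := by
            by_contra hne
            obtain ⟨k, hkS, hk'⟩ := hrun (i + 1) (j + 1) (by omega) (by omega)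
            exact hj (by rw [show j = k from Fin.ext (by omega)]; exact hkS)
          rw [this, bracket_self, mul_zero]
        · have h3 := j.2
          refine mul_nonpos_of_nonpos_of_nonneg (h.isZMatrix i j fun he => ?_)
            (hnn _ _ (by omega) (by omega) (by omega))
          rw [he] at hk
          omega
      · split_ifs with h0
        · rw [show start (i + 1) = 0 by omega, bracket_self, mul_zero]
        · exact le_rfl
      · split_ifs with h0
        · exact mul_nonpos_of_nonpos_of_nonneg h.u_neg.le
            (hnn _ _ (by omega) le_rfl (by omega))
        · exact le_rfl
    · intro j hj
      by_cases hij : Z i j = 0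
      · rw [hij, zero_mul, zero_mul]
      have hstep : ∀ a b : Fin n, a ∈ S → b ∈ S → (a : ℕ) + 1 = b →
          start (b + 1) = start (a + 1) := by
        intro a b _ hb hab
        rw [hab]
        exact Nat.findGreatest_of_not fun hP => hP b hb rfl
      have : start (j + 1) = start (i + 1) := by
        rcases h.eq_or_of_ne_zero hij with hk | hk | hk
        · rw [hk]
        · exact (hstep j i hj hi hk).symm
        · exact hstep i j hi hj hk
      simp only [x, this]
  refine specRadius_le_of_mulVec_le
    (M := M.submatrix (fun i : S => (i : Fin n)) (fun i : S => (i : Fin n))) (fun i j => hM _ _)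
    (fun j : S => x j) (fun j => hxpos j j.2) fun i => ?_
  have h1 : (M.submatrix (fun i : S => (i : Fin n)) (fun i : S => (i : Fin n)) *ᵥ
      fun j : S => x j) i = ∑ j ∈ S, M i j * x j :=
    Finset.sum_coe_sort S fun j => M i j * x j
  have h2 : ∑ j ∈ S, M i j * x j = τ * x i - ∑ j ∈ S, Z i j * x j := by
    have hi : ∑ j ∈ S, (τ • (1 : Matrix (Fin n) (Fin n) ℝ)) i j * x j = τ * x i := by
      rw [Finset.sum_eq_single (i : Fin n)]
      · simp
      · intro j _ hj
        simp [Matrix.one_apply_ne hj.symm]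
      · intro hn
        exact absurd i.2 hn
    rw [← hi, ← Finset.sum_sub_distrib]
    refine Finset.sum_congr rfl fun j _ => ?_
    rw [hZM, Matrix.sub_apply]
    ring
  rw [h1, h2]
  linarith [hZx i i.2]

/-- If brackets of gap at most `s + 1` are nonnegative and one of gap `s + 2` is negative, then
`τ < ρ_{s+1}(M)`: on the interval between the two indices `p` and `m` of the negative bracket, the
vector `bracket f g p ·` is mapped by `Z = τ - M` to a nonzero multiple of the last unit vector. -/
theorem lt_rho (h : IsSolutionPair Z d l u f g) {M : Matrix (Fin n) (Fin n) ℝ} {τ : ℝ}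
    (hτ : 0 ≤ τ) (hZM : Z = τ • (1 : Matrix (Fin n) (Fin n) ℝ) - M) {s p : ℕ}
    (hp : p + s + 2 ≤ n + 1) (hnn : ∀ i, p < i → i < p + s + 2 → 0 ≤ bracket f g p i)
    (hneg : bracket f g p (p + s + 2) < 0) :
    (τ : EReal) < rho M (s + 1) := by
  classical
  rw [rho, if_neg (by omega), if_neg (by omega)]
  let S : Finset (Fin n) := Finset.univ.filter fun j => p ≤ (j : ℕ) ∧ (j : ℕ) ≤ p + s
  have hmem : ∀ j : Fin n, j ∈ S ↔ p ≤ (j : ℕ) ∧ (j : ℕ) ≤ p + s := fun j => by simp [S]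
  have hcard : S.card = s + 1 := by
    have : S.image (fun j : Fin n => (j : ℕ)) = Finset.Icc p (p + s) := by
      ext k
      simp only [Finset.mem_image, Finset.mem_Icc, hmem]
      constructor
      · rintro ⟨j, hj, rfl⟩
        exact hj
      · intro hk
        exact ⟨⟨k, by omega⟩, hk, rfl⟩
    rw [← Finset.card_image_of_injective S Fin.val_injective, this, Nat.card_Icc]
    omega
  have hS : S ∈ (Finset.univ : Finset (Fin n)).powersetCard (s + 1) :=
    Finset.mem_powersetCard.2 ⟨Finset.subset_univ S, hcard⟩
  refine lt_of_lt_of_le ?_ (le_iSup₂ (f := fun (S : Finset (Fin n))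
    (_ : S ∈ (Finset.univ : Finset (Fin n)).powersetCard (s + 1)) =>
    ((specRadius (M.submatrix (fun i : S => (i : Fin n)) (fun i : S => (i : Fin n))) : ENNReal) :
      EReal)) S hS)
  rw [← max_eq_left hτ, ← EReal.coe_ennreal_ofReal, EReal.coe_ennreal_lt_coe_ennreal_iff]
  let y : Fin n → ℝ := fun j => bracket f g p (j + 1)
  let e : Fin n := ⟨p + s, by omega⟩
  have he : e ∈ S := (hmem e).2 (by simp [e])
  have hZy := fun i => h.sum_eq_neg p i S y fun j _ => rfl
  have hterm : ∀ i ∈ S, ∀ j ∈ Sᶜ, 0 ≤ Z i j * bracket f g p (j + 1) := by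
    intro i hi j hj
    rw [Finset.mem_compl, hmem] at hj
    rw [hmem] at hi
    by_cases hij : Z i j = 0
    · rw [hij, zero_mul]
    rcases h.eq_or_of_ne_zero hij with hk | hk | hk
    · omega
    · rw [show (j : ℕ) + 1 = p by omega, bracket_self, mul_zero]
    · rw [show (j : ℕ) + 1 = p + s + 2 by omega]
      exact (mul_pos_of_neg_of_neg (h.superdiagonal_neg i j hk.symm) hneg).le
  have hleft : ∀ i ∈ S, (if (i : ℕ) = 0 then l * bracket f g p 0 else 0) = 0 := by
    intro i hi
    rw [hmem] at hi
    split_ifs with h0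
    · rw [show p = 0 by omega, bracket_self, mul_zero]
    · rfl
  have hright : ∀ i ∈ S,
      0 ≤ (if (i : ℕ) + 1 = n then u * bracket f g p (n + 1) else 0) := by
    intro i hi
    rw [hmem] at hi
    split_ifs with h0
    · rw [show n + 1 = p + s + 2 by omega]
      exact (mul_pos_of_neg_of_neg h.u_neg hneg).le
    · exact le_rfl
  have hle : ∀ i ∈ S, ∑ j ∈ S, Z i j * y j ≤ 0 := by
    intro i hi
    rw [hZy, hleft i hi]
    have h1 := Finset.sum_nonneg (hterm i hi)
    have h2 := hright i hi
    linarith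
  have hlast : ∑ j ∈ S, Z e j * y j < 0 := by
    rw [hZy, hleft e he]
    have h1 := Finset.sum_nonneg (hterm e he)
    have h2 := hright e he
    by_cases hpn : p + s + 1 = n
    · have h3 : 0 < (if (e : ℕ) + 1 = n then u * bracket f g p (n + 1) else 0) := by
        rw [if_pos hpn, show n + 1 = p + s + 2 by omega]
        exact mul_pos_of_neg_of_neg h.u_neg hneg
      linarith
    · have hk : p + s + 1 < n := by omega
      have h3 : 0 < ∑ j ∈ Sᶜ, Z e j * bracket f g p (j + 1) := by
        refine Finset.sum_pos' (hterm e he) ⟨⟨p + s + 1, hk⟩, ?_, ?_⟩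
        · rw [Finset.mem_compl, hmem]
          simp
        · exact mul_pos_of_neg_of_neg (h.superdiagonal_neg e _ rfl) hneg
      linarith
  have hsub : ∀ i : S, (Z.submatrix (fun i : S => (i : Fin n)) (fun i : S => (i : Fin n)) *ᵥ
      fun j : S => y j) i = ∑ j ∈ S, Z i j * y j := fun i =>
    Finset.sum_coe_sort S fun j => Z i j * y j
  refine ofReal_lt_specRadius_of_quadratic_nonpos
    (W := Z.submatrix (fun i : S => (i : Fin n)) (fun i : S => (i : Fin n))) hτ ?_
    (fun i : S => d i) (fun i => h.weight_pos i) (fun i j => h.symm i j) (fun j : S => y j) ?_ ?_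
  · ext i j
    simp only [hZM, Matrix.submatrix_apply, Matrix.sub_apply, Matrix.smul_apply,
      Matrix.one_apply, Subtype.coe_inj]
  · intro h0
    have h1 := congrFun h0 ⟨e, he⟩
    rw [hsub] at h1
    exact hlast.ne h1
  · refine Finset.sum_nonpos fun i _ => ?_
    rw [hsub]
    have hi := (hmem i).1 i.2
    exact mul_nonpos_of_nonneg_of_nonpos (mul_nonneg (h.weight_pos i).le
      (hnn _ (by omega) (by omega))) (hle i i.2)

theorem mem_classL (h : IsSolutionPair Z d l u f g) {s : ℕ} (hs : s ≤ n)
    (hnn : ∀ i k, i < k → k ≤ n + 1 → k ≤ i + s + 1 → 0 ≤ bracket f g i k)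
    (hneg : s < n → ∃ p, p + s + 2 ≤ n + 1 ∧ bracket f g p (p + s + 2) < 0) :
    Z ∈ classL n s := by
  have hτ : 0 ≤ ∑ i, |Z i i| := Finset.sum_nonneg fun i _ => abs_nonneg _
  have hM : ∀ i j, 0 ≤ ((∑ i, |Z i i|) • (1 : Matrix (Fin n) (Fin n) ℝ) - Z) i j := by
    intro i j
    by_cases hij : i = j
    · subst hij
      have h1 := Finset.single_le_sum (f := fun i => |Z i i|) (fun i _ => abs_nonneg _)
        (Finset.mem_univ i)
      simp only [Matrix.sub_apply, Matrix.smul_apply, Matrix.one_apply_eq, smul_eq_mul, mul_one]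
      linarith [le_abs_self (Z i i)]
    · simpa [Matrix.one_apply_ne hij] using h.isZMatrix i j hij
  have hZM : Z = (∑ i, |Z i i|) • (1 : Matrix (Fin n) (Fin n) ℝ) -
      ((∑ i, |Z i i|) • (1 : Matrix (Fin n) (Fin n) ℝ) - Z) := by abel
  refine ⟨hs, _, _, hM, hZM, h.rho_le hτ hM hZM hs hnn, ?_⟩
  rcases hs.lt_or_eq with hlt | heq
  · obtain ⟨p, hp, hpneg⟩ := hneg hlt
    exact h.lt_rho hτ hZM hp (fun i h1 h2 => hnn p i h1 (by omega) (by omega)) hpneg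
  · rw [rho, if_neg (by omega), if_pos (by omega)]
    exact EReal.coe_lt_top _

end IsSolutionPair

/-! ### The solution pair of the inverse of a Green's matrix -/

/-- The sequence on `0, …, n + 1` with the values of `x` at `1, …, n` and the given end values. -/
def extend {n : ℕ} (x : Fin n → ℝ) (x₀ x₁ : ℝ) : ℕ → ℝ
  | 0 => x₀
  | i + 1 => if h : i < n then x ⟨i, h⟩ else x₁

@[simp] theorem extend_zero {n : ℕ} (x : Fin n → ℝ) (x₀ x₁ : ℝ) : extend x x₀ x₁ 0 = x₀ := rfl

@[simp] theorem extend_val {n : ℕ} (x : Fin n → ℝ) (x₀ x₁ : ℝ) (i : Fin n) :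
    extend x x₀ x₁ (i + 1) = x i := by
  simp [extend]

@[simp] theorem extend_last {n : ℕ} (x : Fin n → ℝ) (x₀ x₁ : ℝ) :
    extend x x₀ x₁ (n + 1) = x₁ := by
  simp [extend]

theorem hadamard_apply_of_le {n : ℕ} {A B : Matrix (Fin n) (Fin n) ℝ} {a b : Fin n → ℝ}
    (hA : IsWeakTypeD A a) (hB : IsFlippedWeakTypeD B b) {i j : Fin n} (hij : i ≤ j) :
    Matrix.hadamard A B i j = a i * b j ∧ Matrix.hadamard A B j i = a i * b j := by
  have h1 := hB i.rev j.rev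
  have h2 := hB j.rev i.rev
  simp only [Matrix.submatrix_apply, Fin.rev_rev, Fin.rev_le_rev] at h1 h2
  rw [Matrix.hadamard_apply, Matrix.hadamard_apply, h1, h2, hA, hA, if_pos hij, if_pos hij]
  rcases hij.eq_or_lt with rfl | hlt
  · simp
  · simp [not_le.2 hlt]

section Green

variable {m : ℕ} {C : Matrix (Fin (m + 1)) (Fin (m + 1)) ℝ} {d a b : Fin (m + 1) → ℝ}

/-- `det C` has the sign of `a 0 * b (last)`: by the determinant of a Green's matrix, `x` is the
product of the weights and `y` that of the consecutive brackets. -/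
theorem exists_pos_mul_det (hd : ∀ i, 0 < d i)
    (hup : ∀ i j, i ≤ j → d i * C i j = a i * b j) (hlo : ∀ i j, i ≤ j → d j * C j i = a i * b j)
    (hab : ∀ i k : Fin (m + 1), (k : ℕ) = (i : ℕ) + 1 → 0 < a k * b i - a i * b k) :
    ∃ x y : ℝ, 0 < x ∧ 0 < y ∧ x * C.det = y * (a 0 * b (Fin.last m)) := by
  refine ⟨∏ i, d i, ∏ i ∈ Finset.range m, bracket (fun i => extend a 0 0 (i + 1))
    (fun i => extend b 0 0 (i + 1)) i (i + 1), Finset.prod_pos fun i _ => hd i,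
    Finset.prod_pos fun i hi => ?_, ?_⟩
  · rw [Finset.mem_range] at hi
    have h1 := hab ⟨i, by omega⟩ ⟨i + 1, by omega⟩ rfl
    simpa [bracket, extend, hi, Nat.lt_succ_of_lt hi] using h1
  · have h1 := det_green m (fun i => extend a 0 0 (i + 1)) (fun i => extend b 0 0 (i + 1))
    have h2 : (Matrix.of fun i j : Fin (m + 1) => extend a 0 0 (min (i : ℕ) j + 1) *
        extend b 0 0 (max (i : ℕ) j + 1)) = Matrix.diagonal d * C := by
      ext i j
      rw [Matrix.diagonal_mul, Matrix.of_apply]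
      rcases le_total i j with hij | hij
      · rw [hup i j hij, min_eq_left (Fin.le_def.1 hij), max_eq_right (Fin.le_def.1 hij),
          extend_val, extend_val]
      · rw [hlo j i hij, min_eq_right (Fin.le_def.1 hij), max_eq_left (Fin.le_def.1 hij),
          extend_val, extend_val]
    rw [h2, Matrix.det_mul, Matrix.det_diagonal] at h1
    rw [h1, show extend a 0 0 (0 + 1) = a 0 from extend_val a 0 0 0,
      show extend b 0 0 (m + 1) = b (Fin.last m) from extend_val b 0 0 (Fin.last m)]
    ring

/-- The first and last columns of `C` are multiples of `b / d` and `a / d`, so that `C⁻¹` maps these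
two vectors to multiples of the first and last unit vectors. -/
theorem isSolutionPair_inv (hC : IsUnit C.det) (htri : IsTridiagonal C⁻¹) (hZ : IsZMatrix C⁻¹)
    (hd : ∀ i, 0 < d i)
    (hup : ∀ i j, i ≤ j → d i * C i j = a i * b j) (hlo : ∀ i j, i ≤ j → d j * C j i = a i * b j)
    (hab : ∀ i k : Fin (m + 1), (k : ℕ) = (i : ℕ) + 1 → 0 < a k * b i - a i * b k)
    (ha : a 0 ≠ 0) (hb : b (Fin.last m) ≠ 0) :
    IsSolutionPair C⁻¹ d (-(a 0 * a 0)⁻¹) (-(b (Fin.last m) * b (Fin.last m))⁻¹)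
      (extend (fun i => a i / d i) 0 (b (Fin.last m)))
      (extend (fun i => b i / d i) (a 0) 0) where
  isZMatrix := hZ
  isTridiagonal := htri
  weight_pos := hd
  symm := by
    have h1 : Matrix.diagonal d * C = Cᵀ * Matrix.diagonal d := by
      ext i j
      rw [Matrix.diagonal_mul, Matrix.mul_diagonal, Matrix.transpose_apply, mul_comm (C j i)]
      rcases le_total i j with hij | hij
      · rw [hup i j hij, hlo i j hij]
      · rw [hlo j i hij, hup j i hij]
    have h2 : Matrix.diagonal d * C⁻¹ = (C⁻¹)ᵀ * Matrix.diagonal d := by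
      have hCt : (C⁻¹)ᵀ * Cᵀ = 1 := by
        rw [← Matrix.transpose_mul, Matrix.mul_nonsing_inv C hC, Matrix.transpose_one]
      calc Matrix.diagonal d * C⁻¹ = (C⁻¹)ᵀ * Cᵀ * Matrix.diagonal d * C⁻¹ := by
            rw [hCt, one_mul]
        _ = (C⁻¹)ᵀ * (Cᵀ * Matrix.diagonal d) * C⁻¹ := by simp only [Matrix.mul_assoc]
        _ = (C⁻¹)ᵀ * Matrix.diagonal d * (C * C⁻¹) := by
            rw [← h1]
            simp only [Matrix.mul_assoc]
        _ = (C⁻¹)ᵀ * Matrix.diagonal d := by rw [Matrix.mul_nonsing_inv C hC, mul_one]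
    intro i j
    have h3 := congrFun (congrFun h2 i) j
    rw [Matrix.diagonal_mul, Matrix.mul_diagonal, Matrix.transpose_apply] at h3
    rw [h3, mul_comm]
  l_neg := neg_neg_of_pos (inv_pos.2 (mul_self_pos.2 ha))
  u_neg := neg_neg_of_pos (inv_pos.2 (mul_self_pos.2 hb))
  eq_left := by
    intro i
    have h1 := congrFun (congrFun (Matrix.nonsing_inv_mul C hC) i) (Fin.last m)
    have h2 : (C⁻¹ * C) i (Fin.last m) =
        (∑ j, C⁻¹ i j * extend (fun i => a i / d i) 0 (b (Fin.last m)) (j + 1)) *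
          b (Fin.last m) := by
      rw [Matrix.mul_apply, Finset.sum_mul]
      refine Finset.sum_congr rfl fun j _ => ?_
      rw [extend_val, mul_assoc, div_mul_eq_mul_div, ← hup j _ (Fin.le_last j),
        mul_div_cancel_left₀ _ (hd j).ne']
    rw [h2, Matrix.one_apply] at h1
    rw [extend_zero, extend_last, mul_zero, ite_self, add_zero]
    by_cases hi : i = Fin.last m
    · rw [if_pos hi] at h1
      rw [if_pos (by rw [hi]; rfl), eq_one_div_of_mul_eq_one_left h1]
      field_simp
      ring
    · rw [if_neg hi] at h1
      rw [if_neg fun h => hi (Fin.ext (by simpa using h)), add_zero]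
      exact (mul_eq_zero.1 h1).resolve_right hb
  eq_right := by
    intro i
    have h1 := congrFun (congrFun (Matrix.nonsing_inv_mul C hC) i) 0
    have h2 : (C⁻¹ * C) i 0 =
        (∑ j, C⁻¹ i j * extend (fun i => b i / d i) (a 0) 0 (j + 1)) * a 0 := by
      rw [Matrix.mul_apply, Finset.sum_mul]
      refine Finset.sum_congr rfl fun j _ => ?_
      rw [extend_val, mul_assoc, div_mul_eq_mul_div, mul_comm (b j), ← hlo 0 j (Fin.zero_le j),
        mul_div_cancel_left₀ _ (hd j).ne']
    rw [h2, Matrix.one_apply] at h1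
    rw [extend_zero, extend_last, mul_zero, ite_self, add_zero]
    by_cases hi : i = 0
    · rw [if_pos hi] at h1
      rw [if_pos (by rw [hi]; rfl), eq_one_div_of_mul_eq_one_left h1]
      field_simp
      ring
    · rw [if_neg hi] at h1
      rw [if_neg fun h => hi (Fin.ext (by simpa using h)), add_zero]
      exact (mul_eq_zero.1 h1).resolve_right ha
  bracket_pos := by
    intro i hi
    rcases i with _ | i
    · rw [bracket, extend_zero, extend_zero, zero_mul, sub_zero,
        show extend (fun i => a i / d i) 0 (b (Fin.last m)) (0 + 1) = a 0 / d 0 from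
          extend_val _ _ _ 0, div_mul_eq_mul_div]
      exact div_pos (mul_self_pos.2 ha) (hd 0)
    · rcases hi.lt_or_eq with hlt | heq
      · have h1 := hab ⟨i, by omega⟩ ⟨i + 1, hlt⟩ rfl
        have h2 : ∀ (x : Fin (m + 1) → ℝ) x₀ x₁, extend x x₀ x₁ (i + 1) = x ⟨i, by omega⟩ :=
          fun x x₀ x₁ => extend_val x x₀ x₁ ⟨i, by omega⟩
        have h3 : ∀ (x : Fin (m + 1) → ℝ) x₀ x₁, extend x x₀ x₁ (i + 1 + 1) = x ⟨i + 1, hlt⟩ :=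
          fun x x₀ x₁ => extend_val x x₀ x₁ ⟨i + 1, hlt⟩
        rw [bracket, h2, h2, h3, h3, div_mul_div_comm, div_mul_div_comm,
          mul_comm (d ⟨i, _⟩), ← sub_div]
        exact div_pos h1 (mul_pos (hd _) (hd _))
      · have hlast : ∀ (x : Fin (m + 1) → ℝ) x₀ x₁,
            extend x x₀ x₁ (i + 1) = x (Fin.last m) := by
          intro x x₀ x₁
          rw [show i = m by omega]
          exact extend_val x x₀ x₁ (Fin.last m)
        rw [bracket, hlast, hlast, heq, extend_last, extend_last, mul_zero, sub_zero,
          ← mul_div_assoc]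
        exact div_pos (mul_self_pos.2 hb) (hd _)

end Green

/-! ### The indices `t`, `r` and `q` -/

theorem tIndex_spec {n : ℕ} (a b : Fin n → ℝ) :
    (∀ i k : Fin n, i < k → (k : ℤ) - i < tIndex a b → 0 ≤ a k * b i - a i * b k) ∧
      (tIndex a b = n + 2 ∨
        ∃ i k : Fin n, i < k ∧ (k : ℤ) - i = tIndex a b ∧ a k * b i - a i * b k < 0) := by
  rw [tIndex]
  split_ifs with h
  · exact ⟨fun i k hik _ => h i k hik, Or.inl rfl⟩
  · set J : Set ℕ := {j : ℕ | 1 ≤ j ∧ ∃ i k : Fin n, (k : ℕ) = (i : ℕ) + j ∧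
      a k * b i - a i * b k < 0} with hJ
    constructor
    · intro i k hik hlt
      by_contra hneg
      have hik' := Fin.lt_def.1 hik
      have hmem : (k : ℕ) - i ∈ J := ⟨by omega, i, k, by omega, not_le.1 hneg⟩
      have := Nat.sInf_le hmem
      omega
    · push Not at h
      obtain ⟨i, k, hik, hneg⟩ := h
      have hik' := Fin.lt_def.1 hik
      have hne : J.Nonempty := ⟨(k : ℕ) - i, by omega, i, k, by omega, hneg⟩
      obtain ⟨h1, i', k', h2, h3⟩ := Nat.sInf_mem hne
      exact Or.inr ⟨i', k', Fin.lt_def.2 (by omega), by omega, h3⟩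

theorem sSup_gap_spec {n : ℕ} {P : Fin n → Fin n → Prop} (h : ∃ i k, i ≤ k ∧ P i k) :
    (∀ i k : Fin n, i ≤ k → P i k → (k : ℤ) - i ≤
        (sSup {j : ℕ | ∃ i k : Fin n, (k : ℕ) = (i : ℕ) + j ∧ P i k} : ℕ)) ∧
      ∃ i k : Fin n, i ≤ k ∧ (k : ℤ) - i =
        (sSup {j : ℕ | ∃ i k : Fin n, (k : ℕ) = (i : ℕ) + j ∧ P i k} : ℕ) ∧ P i k := by
  set J : Set ℕ := {j : ℕ | ∃ i k : Fin n, (k : ℕ) = (i : ℕ) + j ∧ P i k} with hJ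
  have hbdd : BddAbove J := by
    refine ⟨n, ?_⟩
    rintro j ⟨i, k, hk, -⟩
    have := k.2
    omega
  constructor
  · intro i k hik hP
    have hik' := Fin.le_def.1 hik
    have hmem : (k : ℕ) - i ∈ J := ⟨i, k, by omega, hP⟩
    have := le_csSup hbdd hmem
    omega
  · obtain ⟨i, k, hik, hP⟩ := h
    have hik' := Fin.le_def.1 hik
    have hmem : (k : ℕ) - i ∈ J := ⟨i, k, by omega, hP⟩
    obtain ⟨i', k', h1, h2⟩ := Nat.sSup_mem ⟨_, hmem⟩ hbdd
    exact ⟨i', k', Fin.le_def.2 (by omega), by omega, h2⟩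

theorem rIndex_spec {n : ℕ} (a b : Fin n → ℝ) :
    (∀ i k : Fin n, i ≤ k → rIndex a b < (k : ℤ) - i → a i * b k ≤ 0) ∧
      (rIndex a b = -1 ∨
        ∃ i k : Fin n, i ≤ k ∧ (k : ℤ) - i = rIndex a b ∧ 0 < a i * b k) := by
  rw [rIndex]
  split_ifs with h
  · exact ⟨fun i k hik _ => h i k hik, Or.inl rfl⟩
  · push Not at h
    obtain ⟨h1, h2⟩ := sSup_gap_spec (P := fun i k => 0 < a i * b k) h
    exact ⟨fun i k hik hlt => not_lt.1 fun hP => (h1 i k hik hP).not_gt hlt, Or.inr h2⟩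

/-- A zero product `a i * b k` forces a negative product of neighbouring parameters, so that `q` is
never the supremum of an empty set. -/
theorem qIndex_spec {m : ℕ} {a b : Fin (m + 1) → ℝ} (h0 : 0 < a 0 * b (Fin.last m))
    (hab : ∀ i k : Fin (m + 1), (k : ℕ) = (i : ℕ) + 1 → 0 < a k * b i - a i * b k) :
    (∀ i k : Fin (m + 1), i ≤ k → qIndex a b < (k : ℤ) - i → 0 ≤ a i * b k) ∧
      (qIndex a b = -2 ∨
        ∃ i k : Fin (m + 1), i ≤ k ∧ (k : ℤ) - i = qIndex a b ∧ a i * b k < 0) := by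
  rw [qIndex]
  split_ifs with h
  · exact ⟨fun i k hik _ => (h i k hik).le, Or.inl rfl⟩
  · push Not at h
    have hex : ∃ i k : Fin (m + 1), i ≤ k ∧ a i * b k < 0 := by
      obtain ⟨i, k, hik, hle⟩ := h
      rcases hle.lt_or_eq with hlt | heq
      · exact ⟨i, k, hik, hlt⟩
      rcases mul_eq_zero.1 heq with ha | hb
      · have hi0 : (i : ℕ) ≠ 0 := by
          intro hi
          rw [show i = 0 from Fin.ext hi] at ha
          rw [ha, zero_mul] at h0
          exact h0.false
        have hi := i.2
        refine ⟨⟨i - 1, by omega⟩, i, Fin.le_def.2 (by simp), ?_⟩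
        have h1 := hab ⟨i - 1, by omega⟩ i (by simp only; omega)
        rw [ha, zero_mul] at h1
        linarith
      · have hkm : (k : ℕ) ≠ m := by
          intro hk
          rw [show k = Fin.last m from Fin.ext hk] at hb
          rw [hb, mul_zero] at h0
          exact h0.false
        have hk := k.2
        refine ⟨k, ⟨k + 1, by omega⟩, Fin.le_def.2 (by simp), ?_⟩
        have h1 := hab k ⟨k + 1, by omega⟩ rfl
        rw [hb, mul_zero] at h1
        linarith
    obtain ⟨h1, h2⟩ := sSup_gap_spec (P := fun i k => a i * b k < 0) hex
    exact ⟨fun i k hik hlt => not_lt.1 fun hP => (h1 i k hik hP).not_gt hlt, Or.inr h2⟩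

/-- Both cases of the theorem together: `σ = 1` and `R = r` if `a 0 * b (last) < 0`, `σ = -1` and
`R = q` if `a 0 * b (last) > 0`. The number `min T (n - R)` is the least gap of a negative bracket:
`T` is the least one between the indices `1, …, n`, and `n - R` the least one that involves `0` or
`n + 1`, since a largest gap of a positive `σ * (a i * b k)` is attained with `i` first or `k` last.
Here `n` is `m + 1`. -/
theorem exists_mem_classL {m : ℕ} {Z : Matrix (Fin (m + 1)) (Fin (m + 1)) ℝ}
    {d a b : Fin (m + 1) → ℝ} {l u σ : ℝ} {T R : ℤ}
    (hsol : IsSolutionPair Z d l u (extend (fun i => a i / d i) 0 (b (Fin.last m)))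
      (extend (fun i => b i / d i) (a 0) 0))
    (hab : ∀ i k : Fin (m + 1), (k : ℕ) = (i : ℕ) + 1 → 0 < a k * b i - a i * b k)
    (hσ : σ * (a 0 * b (Fin.last m)) < 0)
    (hT : ∀ i k : Fin (m + 1), i < k → (k : ℤ) - i < T → 0 ≤ a k * b i - a i * b k)
    (hT' : T = (m + 1 : ℕ) + 2 ∨
      ∃ i k : Fin (m + 1), i < k ∧ (k : ℤ) - i = T ∧ a k * b i - a i * b k < 0)
    (hR : ∀ i k : Fin (m + 1), i ≤ k → R < (k : ℤ) - i → σ * (a i * b k) ≤ 0)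
    (hR' : (R = -1 ∧ a 0 * b (Fin.last m) < 0) ∨ (R = -2 ∧ 0 < a 0 * b (Fin.last m)) ∨
      ∃ i k : Fin (m + 1), i ≤ k ∧ (k : ℤ) - i = R ∧ 0 < σ * (a i * b k)) :
    ∃ s : ℕ, (s : ℤ) = min (T - 2) ((m + 1 : ℕ) - R - 2) ∧ Z ∈ classL (m + 1) s := by
  have hd := hsol.weight_pos
  set f := extend (fun i => a i / d i) 0 (b (Fin.last m)) with hf
  set g := extend (fun i => b i / d i) (a 0) 0 with hg
  have hin : ∀ i k : Fin (m + 1), bracket f g (i + 1) (k + 1) =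
      (a k * b i - a i * b k) / (d i * d k) := by
    intro i k
    have := (hd i).ne'
    have := (hd k).ne'
    simp only [bracket, hf, hg, extend_val]
    field_simp
  have hl : ∀ k : Fin (m + 1), bracket f g 0 (k + 1) = a k * a 0 / d k := by
    intro k
    simp only [bracket, hf, hg, extend_val, extend_zero]
    ring
  have hr : ∀ i : Fin (m + 1), bracket f g (i + 1) (m + 1 + 1) =
      b (Fin.last m) * b i / d i := by
    intro i
    simp only [bracket, hf, hg, extend_val, extend_last]
    ring
  have hlr : bracket f g 0 (m + 1 + 1) = a 0 * b (Fin.last m) := by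
    simp only [bracket, hf, hg, extend_last, extend_zero]
    ring
  have hsq : 0 < a 0 * b (Fin.last m) * (a 0 * b (Fin.last m)) := by
    refine mul_self_pos.2 fun h0 => ?_
    rw [h0, mul_zero] at hσ
    exact hσ.false
  have hT2 : 2 ≤ T := by
    rcases hT' with h | ⟨i, k, hik, h1, h2⟩
    · omega
    · have hik' := Fin.lt_def.1 hik
      by_contra hlt
      exact (hab i k (by omega)).not_gt h2
  have hTn : T ≤ (m + 1 : ℕ) + 2 := by
    rcases hT' with h | ⟨i, k, hik, h1, h2⟩
    · omega
    · have := k.2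
      omega
  have hRn : -2 ≤ R ∧ R ≤ m - 1 := by
    rcases hR' with ⟨h, -⟩ | ⟨h, -⟩ | ⟨i, k, hik, h1, h2⟩
    · omega
    · omega
    · have hik' := Fin.le_def.1 hik
      have hk := k.2
      refine ⟨by omega, ?_⟩
      by_contra hlt
      rw [show i = 0 from Fin.ext (by simp only [Fin.val_zero]; omega),
        show k = Fin.last m from Fin.ext (by simp only [Fin.val_last]; omega)] at h2
      exact hσ.not_gt h2
  obtain ⟨s, hs⟩ : ∃ s : ℕ, (s : ℤ) = min (T - 2) ((m + 1 : ℕ) - R - 2) :=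
    ⟨(min (T - 2) ((m + 1 : ℕ) - R - 2)).toNat, Int.toNat_of_nonneg (by omega)⟩
  refine ⟨s, hs, hsol.mem_classL (by omega) ?_ ?_⟩
  · intro i k hik hk hgap
    rcases i with _ | i
    · obtain ⟨k, rfl⟩ : ∃ k', k = k' + 1 := ⟨k - 1, by omega⟩
      rcases hk.lt_or_eq with hlt | heq
      · have hkm : k < m + 1 := by omega
        rw [hl ⟨k, hkm⟩]
        refine div_nonneg ?_ (hd _).le
        have h1 := hR ⟨k, hkm⟩ (Fin.last m) (Fin.le_last _)
          (by simp only [Fin.val_last]; omega)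
        by_contra hneg
        nlinarith [mul_pos_of_neg_of_neg (not_le.1 hneg) hσ,
          mul_nonpos_of_nonpos_of_nonneg h1 (mul_self_nonneg (a 0)),
          mul_self_nonneg (b (Fin.last m))]
      · rw [show k = m + 1 by omega, hlr]
        rcases hR' with ⟨h, -⟩ | ⟨-, h⟩ | ⟨i, k', hik', h1, h2⟩
        · omega
        · exact h.le
        · have := Fin.le_def.1 hik'
          omega
    · obtain ⟨k, rfl⟩ : ∃ k', k = k' + 1 := ⟨k - 1, by omega⟩
      have him : i < m + 1 := by omega
      rcases hk.lt_or_eq with hlt | heq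
      · have hkm : k < m + 1 := by omega
        rw [hin ⟨i, him⟩ ⟨k, hkm⟩]
        exact div_nonneg (hT _ _ (Fin.lt_def.2 (by simp only; omega)) (by simp only; omega))
          (mul_pos (hd _) (hd _)).le
      · rw [show k = m + 1 by omega, hr ⟨i, him⟩]
        refine div_nonneg ?_ (hd _).le
        have h1 := hR 0 ⟨i, him⟩ (Fin.zero_le _) (by simp only [Fin.val_zero]; omega)
        by_contra hneg
        nlinarith [mul_pos_of_neg_of_neg (not_le.1 hneg) hσ,
          mul_nonpos_of_nonpos_of_nonneg h1 (mul_self_nonneg (b (Fin.last m)))]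
  · intro hsn
    by_cases hTR : T ≤ (m + 1 : ℕ) - R
    · rcases hT' with h | ⟨i, k, hik, h1, h2⟩
      · omega
      · have := k.2
        refine ⟨i + 1, by omega, ?_⟩
        rw [show (i : ℕ) + 1 + s + 2 = k + 1 by omega, hin]
        exact div_neg_of_neg_of_pos h2 (mul_pos (hd _) (hd _))
    · rcases hR' with ⟨h, h1⟩ | ⟨h, -⟩ | ⟨i, k, hik, h1, h2⟩
      · refine ⟨0, by omega, ?_⟩
        rw [show 0 + s + 2 = m + 1 + 1 by omega, hlr]
        exact h1
      · omega
      · have hik' := Fin.le_def.1 hik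
        have hk := k.2
        by_cases hi : 0 < σ * (a i * b (Fin.last m))
        · have hkm : (k : ℕ) = m := by
            by_contra hne
            refine (hR i (Fin.last m) (Fin.le_last i) ?_).not_gt hi
            simp only [Fin.val_last]
            omega
          refine ⟨0, by omega, ?_⟩
          rw [show 0 + s + 2 = i + 1 by omega, hl]
          refine div_neg_of_neg_of_pos ?_ (hd _)
          by_contra hneg
          -- Products of two of the signs recover the sign of `a i * a 0` without dividing.
          nlinarith [mul_neg_of_pos_of_neg hi hσ,
            mul_nonneg (not_lt.1 hneg) (mul_self_nonneg (σ * b (Fin.last m)))]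
        · have h4 : 0 < σ * (a 0 * b k) := by
            by_contra hneg
            nlinarith [mul_neg_of_pos_of_neg h2 hσ,
              mul_nonneg_of_nonpos_of_nonpos (not_lt.1 hi) (not_lt.1 hneg)]
          have hi0 : (i : ℕ) = 0 := by
            by_contra hne
            refine (hR 0 k (Fin.zero_le k) ?_).not_gt h4
            simp only [Fin.val_zero]
            omega
          refine ⟨k + 1, by omega, ?_⟩
          rw [show (k : ℕ) + 1 + s + 2 = m + 1 + 1 by omega, hr]
          refine div_neg_of_neg_of_pos ?_ (hd _)
          by_contra hneg
          nlinarith [mul_neg_of_pos_of_neg h4 hσ,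
            mul_nonneg (not_lt.1 hneg) (mul_self_nonneg (σ * a 0))]

end ZClass
end

theorem mainTheorem2 (n : ℕ) (hn : 0 < n)
    (C : Matrix (Fin n) (Fin n) ℝ)
    (hC : IsUnit C.det)
    (hirr : ZClass.IsIrreducible C)
    (htri : ZClass.IsTridiagonal C⁻¹)
    (hZ : ZClass.IsZMatrix C⁻¹)
    (d : Fin n → ℝ) (hd : ∀ i, 0 < d i)
    (A B : Matrix (Fin n) (Fin n) ℝ) (a b : Fin n → ℝ)
    (hA : ZClass.IsWeakTypeD A a)
    (hB : ZClass.IsFlippedWeakTypeD B b)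
    (hDC : Matrix.diagonal d * C = Matrix.hadamard A B)
    (hab : ∀ i k : Fin n, (k : ℕ) = (i : ℕ) + 1 → 0 < a k * b i - a i * b k) :
    (C.det < 0 → ∃ s : ℕ,
      (s : ℤ) = min (ZClass.tIndex a b - 2) ((n : ℤ) - ZClass.rIndex a b - 2) ∧
      C⁻¹ ∈ ZClass.classL n s) ∧
    (0 < C.det → ∃ s : ℕ,
      (s : ℤ) = min (ZClass.tIndex a b - 2) ((n : ℤ) - ZClass.qIndex a b - 2) ∧
      C⁻¹ ∈ ZClass.classL n s) := by
  obtain ⟨m, rfl⟩ : ∃ m, n = m + 1 := ⟨n - 1, by omega⟩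
  have hup : ∀ i j, i ≤ j → d i * C i j = a i * b j := by
    intro i j hij
    rw [← (ZClass.hadamard_apply_of_le hA hB hij).1, ← hDC, Matrix.diagonal_mul]
  have hlo : ∀ i j, i ≤ j → d j * C j i = a i * b j := by
    intro i j hij
    rw [← (ZClass.hadamard_apply_of_le hA hB hij).2, ← hDC, Matrix.diagonal_mul]
  obtain ⟨x, y, hx, hy, hxy⟩ := ZClass.exists_pos_mul_det hd hup hlo hab
  have hne : a 0 * b (Fin.last m) ≠ 0 := by
    intro h0
    rw [h0, mul_zero] at hxy
    exact (mul_ne_zero hx.ne' hC.ne_zero) hxy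
  have hsol := ZClass.isSolutionPair_inv hC htri hZ hd hup hlo hab (left_ne_zero_of_mul hne)
    (right_ne_zero_of_mul hne)
  obtain ⟨hT, hT'⟩ := ZClass.tIndex_spec a b
  constructor
  · intro hdet
    have hneg : a 0 * b (Fin.last m) < 0 := by
      have h1 := mul_neg_of_pos_of_neg hx hdet
      rw [hxy] at h1
      exact neg_of_mul_neg_right h1 hy.le
    obtain ⟨hR, hR'⟩ := ZClass.rIndex_spec a b
    refine ZClass.exists_mem_classL (σ := 1) hsol hab (by rwa [one_mul]) hT hT'
      (fun i k hik hlt => by rw [one_mul]; exact hR i k hik hlt) ?_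
    rcases hR' with h | h
    · exact Or.inl ⟨h, hneg⟩
    · simp only [one_mul]
      exact Or.inr (Or.inr h)
  · intro hdet
    have hpos : 0 < a 0 * b (Fin.last m) := by
      have h1 := mul_pos hx hdet
      rw [hxy] at h1
      exact pos_of_mul_pos_right h1 hy.le
    obtain ⟨hQ, hQ'⟩ := ZClass.qIndex_spec hpos hab
    refine ZClass.exists_mem_classL (σ := -1) hsol hab (by linarith) hT hT'
      (fun i k hik hlt => by linarith [hQ i k hik hlt]) ?_
    rcases hQ' with h | ⟨i, k, h1, h2, h3⟩
    · exact Or.inr (Or.inl ⟨h, hpos⟩)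
    · exact Or.inr (Or.inr ⟨i, k, h1, h2, by linarith⟩)
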